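/- Let $\alpha>0$, let $t<n$ be natural numbers with $t\ge 1$, and let $Q_i(x)=v_i+\frac{\alpha}{2}\|x-c_i\|^2$ for $i=1,\dots,t$, where $v_i\in\mathbb{R}$, $c_i\in\mathbb{R}^n$ and $\|\cdot\|$ is the Euclidean norm. For $\lambda$ in the simplex $\Delta_t=\{\lambda\in\mathbb{R}^t:\lambda\ge 0,\ \sum_i\lambda_i=1\}$ put $Q_\lambda=\sum_{i=1}^t\lambda_iQ_i$ and $$v_\lambda=\sum_{i=1}^t\lambda_i\Bigl(\frac{\alpha}{2}\|c_i\|^2+v_i\Bigr)-\frac{\alpha}{2}\Bigl\|\sum_{i=1}^t\lambda_ic_i\Bigr\|^2,$$ which is the minimal value of $Q_\lambda$ on $\mathbb{R}^n$. Let $Q$ be the optimal averaging of $Q_1,\dots,Q_t$, that is, $Q=Q_{\bar\lambda}$ where $\bar\lambda$ maximizes $v_\lambda$ over $\Delta_t$. Fix a real number $s$ with $s\ge v_i$ for all $i$, and let $B_i=\{x\in\mathbb{R}^n:Q_i(x)\le s\}$. If $\bigcap_{i=1}^tB_i$ has nonempty interior, then $B=\{x\in\mathbb{R}^n:Q(x)\le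 s\}$ is the minimal enclosing ball of $\bigcap_{i=1}^tB_i$: $B$ is a closed Euclidean ball containing $\bigcap_{i=1}^tB_i$, every closed ball containing $\bigcap_{i=1}^tB_i$ has radius at least that of $B$, and $B$ is the only such ball with that radius. -/

import Mathlib

namespace OptQuadAvg

/-- The quadratic `x ↦ v + (α/2) ‖x - c‖²` on `ℝⁿ`. -/
noncomputable def quad {n : ℕ} (α v : ℝ) (c : EuclideanSpace ℝ (Fin n)) :
    EuclideanSpace ℝ (Fin n) → ℝ :=
  fun x => v + α / 2 * ‖x - c‖ ^ 2

/-- The average `Q_w = ∑ i, w i * Q_i` of the quadratics `Q_i = v i + (α/2) ‖· - c i‖²`. -/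
noncomputable def avgQuad {n t : ℕ} (α : ℝ) (v : Fin t → ℝ)
    (c : Fin t → EuclideanSpace ℝ (Fin n)) (w : Fin t → ℝ) :
    EuclideanSpace ℝ (Fin n) → ℝ :=
  fun x => ∑ i, w i * quad α (v i) (c i) x

/-- The number `v_w = ⟨(α/2) diag(CᵀC) + v, w⟩ - (α/2) ‖C w‖²`, where `C` is the matrix with
columns `c i`. For `w` in the simplex and `α > 0` this is the minimal value of `avgQuad α v c w`. -/
noncomputable def avgValue {n t : ℕ} (α : ℝ) (v : Fin t → ℝ)
    (c : Fin t → EuclideanSpace ℝ (Fin n)) (w : Fin t → ℝ) : ℝ :=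
  ∑ i, (α / 2 * ‖c i‖ ^ 2 + v i) * w i - α / 2 * ‖∑ i, w i • c i‖ ^ 2

/-- `Q` is the optimal averaging of the quadratics `Q_i`: it is the average `Q_w` for a weight
vector `w` in the simplex that maximizes `v_w` over the simplex. -/
def IsOptimalAveraging {n t : ℕ} (α : ℝ) (v : Fin t → ℝ)
    (c : Fin t → EuclideanSpace ℝ (Fin n)) (Q : EuclideanSpace ℝ (Fin n) → ℝ) : Prop :=
  ∃ w ∈ stdSimplex ℝ (Fin t),
    IsMaxOn (avgValue α v c) (stdSimplex ℝ (Fin t)) w ∧ Q = avgQuad α v c w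

/-- `B` is the minimal enclosing ball of `K`: it is a closed ball containing `K`, every closed
ball containing `K` has at least the same radius, and it is the only one of that radius. -/
def IsMinimalEnclosingBall {n : ℕ} (B K : Set (EuclideanSpace ℝ (Fin n))) : Prop :=
  ∃ (z : EuclideanSpace ℝ (Fin n)) (r : ℝ), 0 ≤ r ∧ B = Metric.closedBall z r ∧ K ⊆ B ∧
    ∀ (z' : EuclideanSpace ℝ (Fin n)) (r' : ℝ), 0 ≤ r' → K ⊆ Metric.closedBall z' r' →
      r ≤ r' ∧ (r' = r → z' = z)

end OptQuadAvg

/-!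
Write `z = ∑ i, w i • c i` for the centre of the average `Q_w`. Completing the square gives
`Q_w x = v_w + (α/2) ‖x - z‖²` (`OptQuadAvg.avgQuad_eq`), so `{Q_w ≤ s}` is the closed ball of
radius `r = √(2 (s - v_w) / α)` about `z`, and it contains `⋂ i, {Q_i ≤ s}` because `Q_w` is a
convex combination of the `Q_i`.

Optimality of `w` enters through its first-order condition: `Q_i z ≤ v_w` for every `i`
(`OptQuadAvg.quad_center_le_avgValue`), obtained by moving `w` slightly towards the `i`-th vertex
of the simplex. As there are fewer than `n` centres, some unit vector `u` is orthogonal to every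
`z - c i`. Along `u` all the quadratics grow at the same rate, so
`Q_i (z ± r u) = Q_i z + (α/2) r² ≤ s`: the intersection contains two antipodal boundary points
of the ball. A set containing two antipodal points of a closed ball lies in no smaller ball, and in
no other ball of the same radius (`OptQuadAvg.sq_dist_add_sq_le_of_antipodal`).
-/

namespace OptQuadAvg

variable {n t : ℕ}

/-- Completing the square in a weighted average of quadratics. -/
lemma avgQuad_eq (α : ℝ) (v : Fin t → ℝ) (c : Fin t → EuclideanSpace ℝ (Fin n))
    {w : Fin t → ℝ} (hw : ∑ i, w i = 1) (x : EuclideanSpace ℝ (Fin n)) :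
    avgQuad α v c w x = avgValue α v c w + α / 2 * ‖x - ∑ i, w i • c i‖ ^ 2 := by
  have hterm : ∀ i, w i * quad α (v i) (c i) x =
      (α / 2 * ‖c i‖ ^ 2 + v i) * w i + α / 2 * ‖x‖ ^ 2 * w i - α * (w i * inner ℝ x (c i)) := by
    intro i
    rw [quad, norm_sub_sq_real]
    ring
  rw [avgQuad, avgValue, norm_sub_sq_real, inner_sum, Finset.sum_congr rfl fun i _ => hterm i,
    Finset.sum_sub_distrib, Finset.sum_add_distrib, ← Finset.mul_sum, ← Finset.mul_sum, hw]
  simp only [inner_smul_right]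
  ring

/-- The first-order optimality condition for `w`: the centre of the optimal average lies in every
sublevel set `{Q_i ≤ v_w}`. -/
lemma quad_center_le_avgValue {α : ℝ} {v : Fin t → ℝ} {c : Fin t → EuclideanSpace ℝ (Fin n)}
    {w : Fin t → ℝ} (hw : w ∈ stdSimplex ℝ (Fin t))
    (hmax : IsMaxOn (avgValue α v c) (stdSimplex ℝ (Fin t)) w) (i : Fin t) :
    quad α (v i) (c i) (∑ j, w j • c j) ≤ avgValue α v c w := by
  set z := ∑ j, w j • c j with hz
  have hzw : avgQuad α v c w z = avgValue α v c w := by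
    rw [avgQuad_eq α v c hw.2, ← hz]
    simp
  have key : ∀ ε : ℝ, 0 < ε → ε ≤ 1 →
      quad α (v i) (c i) z - avgValue α v c w ≤ ε * (α / 2 * ‖z - c i‖ ^ 2) := by
    intro ε h0 h1
    set w' : Fin t → ℝ := (1 - ε) • w + ε • Pi.single i 1 with hw'
    have hmem : w' ∈ stdSimplex ℝ (Fin t) :=
      convex_stdSimplex ℝ (Fin t) hw (single_mem_stdSimplex ℝ i) (by linarith) h0.le (by ring)
    have hcenter : ∑ j, w' j • c j = (1 - ε) • z + ε • c i := by
      simp [hw', add_smul, Finset.sum_add_distrib, mul_smul, ← Finset.smul_sum, hz,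
        Pi.single_apply, ite_smul]
    have hval : avgQuad α v c w' z =
        (1 - ε) * avgValue α v c w + ε * quad α (v i) (c i) z := by
      rw [← hzw]
      simp [avgQuad, hw', add_mul, Finset.sum_add_distrib, mul_assoc, ← Finset.mul_sum,
        Pi.single_apply]
    have hsub : z - ((1 - ε) • z + ε • c i) = ε • (z - c i) := by module
    rw [avgQuad_eq α v c hmem.2, hcenter, hsub, norm_smul, Real.norm_of_nonneg h0.le] at hval
    have hle : avgValue α v c w' ≤ avgValue α v c w := hmax hmem
    refine le_of_mul_le_mul_left ?_ h0
    linarith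
  have hlim : Filter.Tendsto (fun ε : ℝ => ε * (α / 2 * ‖z - c i‖ ^ 2))
      (nhdsWithin 0 (Set.Ioi 0)) (nhds 0) := by
    have : Continuous fun ε : ℝ => ε * (α / 2 * ‖z - c i‖ ^ 2) := by fun_prop
    simpa using (this.tendsto 0).mono_left nhdsWithin_le_nhds
  have := ge_of_tendsto hlim (b := quad α (v i) (c i) z - avgValue α v c w) <| by
    filter_upwards [Ioc_mem_nhdsGT (zero_lt_one' ℝ)] with ε hε using key ε hε.1 hε.2
  linarith

/-- Fewer than `n` vectors of `ℝⁿ` have a common unit normal. -/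
lemma exists_norm_eq_one_forall_inner_eq_zero (htn : t < n)
    (d : Fin t → EuclideanSpace ℝ (Fin n)) :
    ∃ u : EuclideanSpace ℝ (Fin n), ‖u‖ = 1 ∧ ∀ i, inner ℝ (d i) u = 0 := by
  have hne : (Submodule.span ℝ (Set.range d))ᗮ ≠ ⊥ := by
    intro h
    have hle : Module.finrank ℝ (Submodule.span ℝ (Set.range d)) ≤ t := by
      simpa [Set.finrank] using finrank_range_le_card (R := ℝ) d
    rw [Submodule.orthogonal_eq_bot_iff.1 h, finrank_top, finrank_euclideanSpace_fin] at hle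
    omega
  obtain ⟨y, hy, hy0⟩ := Submodule.exists_mem_ne_zero_of_ne_bot hne
  refine ⟨‖y‖⁻¹ • y, norm_smul_inv_norm (𝕜 := ℝ) hy0, fun i => ?_⟩
  rw [inner_smul_right, (Submodule.mem_orthogonal _ y).1 hy _
    (Submodule.subset_span (Set.mem_range_self i)), mul_zero]

/-- If a closed ball contains the two antipodal points `z ± p`, then the parallelogram law bounds
both `‖p‖` and the distance of its centre from `z`. -/
lemma sq_dist_add_sq_le_of_antipodal {E : Type*} [NormedAddCommGroup E] [InnerProductSpace ℝ E]
    {z p z' : E} {r' : ℝ} (h₁ : z + p ∈ Metric.closedBall z' r')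
    (h₂ : z - p ∈ Metric.closedBall z' r') :
    ‖z - z'‖ ^ 2 + ‖p‖ ^ 2 ≤ r' ^ 2 := by
  rw [mem_closedBall_iff_norm] at h₁ h₂
  have h := parallelogram_law_with_norm ℝ (z - z') p
  rw [show z - z' + p = z + p - z' by abel, show z - z' - p = z - p - z' by abel] at h
  nlinarith [pow_le_pow_left₀ (norm_nonneg _) h₁ 2, pow_le_pow_left₀ (norm_nonneg _) h₂ 2]

end OptQuadAvg

open OptQuadAvg in
theorem mainTheorem4 (n t : ℕ) (htn : t < n) (α : ℝ) (hα : 0 < α)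
    (v : Fin t → ℝ) (c : Fin t → EuclideanSpace ℝ (Fin n))
    (Q : EuclideanSpace ℝ (Fin n) → ℝ) (hQ : OptQuadAvg.IsOptimalAveraging α v c Q)
    (s : ℝ) (hs : ∀ i, v i ≤ s)
    (hint : (interior (⋂ i, {x | OptQuadAvg.quad α (v i) (c i) x ≤ s})).Nonempty) :
    OptQuadAvg.IsMinimalEnclosingBall {x | Q x ≤ s}
      (⋂ i, {x | OptQuadAvg.quad α (v i) (c i) x ≤ s}) := by
  obtain ⟨w, hw, hmax, rfl⟩ := hQ
  set z := ∑ i, w i • c i with hz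
  have hsub : (⋂ i, {x | quad α (v i) (c i) x ≤ s}) ⊆ {x | avgQuad α v c w x ≤ s} := by
    intro x hx
    rw [Set.mem_iInter] at hx
    calc avgQuad α v c w x ≤ ∑ i, w i * s :=
          Finset.sum_le_sum fun i _ => mul_le_mul_of_nonneg_left (hx i) (hw.1 i)
      _ = s := by rw [← Finset.sum_mul, hw.2, one_mul]
  -- A point of the intersection shows that the radius below is the root of a nonnegative number.
  have hval : avgValue α v c w ≤ s := by
    obtain ⟨x, hx⟩ := hint
    have h : avgQuad α v c w x ≤ s := hsub (interior_subset hx)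
    rw [avgQuad_eq α v c hw.2] at h
    have : 0 ≤ α / 2 * ‖x - ∑ i, w i • c i‖ ^ 2 := by positivity
    linarith
  set r := √(2 * (s - avgValue α v c w) / α) with hr
  have hr0 : 0 ≤ r := Real.sqrt_nonneg _
  have hrsq : α / 2 * r ^ 2 = s - avgValue α v c w := by
    rw [hr, Real.sq_sqrt (div_nonneg (by linarith) hα.le)]
    field_simp
  have hball : {x | avgQuad α v c w x ≤ s} = Metric.closedBall z r := by
    ext x
    rw [Set.mem_ofPred_eq, avgQuad_eq α v c hw.2, mem_closedBall_iff_norm, ← hz,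
      ← pow_le_pow_iff_left₀ (norm_nonneg _) hr0 two_ne_zero,
      ← mul_le_mul_iff_right₀ (b := ‖x - z‖ ^ 2) (half_pos hα), hrsq, le_sub_iff_add_le']
  obtain ⟨u, hu, hperp⟩ := exists_norm_eq_one_forall_inner_eq_zero htn fun i => z - c i
  have hmem : ∀ a : ℝ, a ^ 2 = r ^ 2 → z + a • u ∈ ⋂ i, {x | quad α (v i) (c i) x ≤ s} := by
    intro a ha
    refine Set.mem_iInter.2 fun i => ?_
    have h : v i + α / 2 * ‖z - c i‖ ^ 2 ≤ avgValue α v c w := quad_center_le_avgValue hw hmax i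
    rw [Set.mem_ofPred_eq, quad, show z + a • u - c i = z - c i + a • u by abel, norm_add_sq_real,
      inner_smul_right, hperp i, norm_smul, hu, mul_one, Real.norm_eq_abs, sq_abs, ha]
    linarith
  refine ⟨z, r, hr0, hball, hsub, fun z' r' hr' hK => ?_⟩
  have hbound := sq_dist_add_sq_le_of_antipodal (hK (hmem r rfl))
    (by simpa [sub_eq_add_neg] using hK (hmem (-r) (neg_sq r)))
  rw [norm_smul, hu, mul_one, Real.norm_of_nonneg hr0] at hbound
  refine ⟨le_of_sq_le_sq ?_ hr', ?_⟩
  · nlinarith [sq_nonneg ‖z - z'‖]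
  · rintro rfl
    have : ‖z - z'‖ ^ 2 = 0 := le_antisymm (by linarith) (sq_nonneg _)
    rw [sq_eq_zero_iff, norm_eq_zero, sub_eq_zero] at this
    exact this.symm
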